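/- Let $\Gamma$ be a group. For a finite symmetric generating set $S$ of $\Gamma$ let $\|\gamma\|_S$ denote the word length of $\gamma\in\Gamma$, let $d_S(g,h)=\|g^{-1}h\|_S$ be the word metric, and let $$\|\gamma\|_{S,\infty}=\lim_{n\to\infty}\frac{\|\gamma^n\|_S}{n}$$ be the stable norm of $\gamma$ (the limit always exists). A finitely generated group $\Gamma$ has Property FSL if for every finite symmetric generating set $S$ of $\Gamma$ and every real number $D>1$, the set of automorphisms $$\mathcal D=\{\psi\in\operatorname{Aut}(\Gamma) : \|\psi(\gamma)\|_{S,\infty}\le D\,\|\gamma\|_{S,\infty}\ \text{ for all }\gamma\in\Gamma\}$$ (the automorphisms that are $D$-Lipschitz for the stable norm) has finite image in $\operatorname{Out}(\Gamma)=\operatorname{Aut}(\Gamma)/\operatorname{Inn}(\Gamma)$. **Proposition.** Every hyperbolic group has Property FSL. Here $\Gamma$ is hyperbolic if for some finite symmetric generating set $S$ the metric $d_S$ is Gromov hyperbolic, i.e. there is $\delta\in\mathbb R$ with $$(x\mid z)_w\ \ge\ \min\{(x\mid y)_w,(y\mid z)_w\}-\delta\quad\text{for all } w,x,y,z\in\Gamma,\qquad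 (x\mid y)_w=\tfrac12\bigl(d_S(x,w)+d_S(y,w)-d_S(x,y)\bigr).$$ -/

import Mathlib

noncomputable section

namespace HypGroup

variable {Γ : Type*} [Group Γ]

/-- `S` is a finite symmetric generating set of the group `Γ`. -/
structure IsFiniteSymmGen (S : Set Γ) : Prop where
  finite : S.Finite
  symm : ∀ s ∈ S, s⁻¹ ∈ S
  gen : Subgroup.closure S = ⊤

/-- The word norm of `g`: the least length of a word in the letters `S` that represents `g`. -/
def wordNorm (S : Set Γ) (g : Γ) : ℕ :=
  sInf {n : ℕ | ∃ l : List Γ, (∀ x ∈ l, x ∈ S) ∧ l.prod = g ∧ l.length = n}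

/-- The (left-invariant) word metric, that is, the distance between vertices of the
Cayley graph of `Γ` with respect to `S`. -/
def wordDist (S : Set Γ) (g h : Γ) : ℝ := wordNorm S (g⁻¹ * h)

/-- The Gromov product `(x | y)_w` with respect to a distance function `d`. -/
def gromovProduct {X : Type*} (d : X → X → ℝ) (w x y : X) : ℝ :=
  (d x w + d y w - d x y) / 2

/-- Gromov hyperbolicity of a distance function `d` with constant `δ`. -/
def IsGromovHyperbolic {X : Type*} (d : X → X → ℝ) (δ : ℝ) : Prop :=
  ∀ w x y z : X,
    min (gromovProduct d w x y) (gromovProduct d w y z) - δ ≤ gromovProduct d w x z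

/-- `Γ` is a hyperbolic group: it has a finite symmetric generating set whose word metric is
Gromov hyperbolic. -/
def IsHyperbolicGroup (Γ : Type*) [Group Γ] : Prop :=
  ∃ S : Set Γ, IsFiniteSymmGen S ∧ ∃ δ : ℝ, IsGromovHyperbolic (wordDist S) δ

/-- The stable norm `‖γ‖_∞ = lim ‖γ ^ n‖ / n` (the limit exists, see `tendsto_stableNorm`). -/
def stableNorm (S : Set Γ) (γ : Γ) : ℝ :=
  Filter.atTop.limUnder (fun n : ℕ => (wordNorm S (γ ^ n) : ℝ) / n)

/-- The set of automorphisms of `Γ` that are `D`-Lipschitz for the stable norm. -/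
def lipschitzAut (S : Set Γ) (D : ℝ) : Set (MulAut Γ) :=
  {ψ | ∀ γ : Γ, stableNorm S (ψ γ) ≤ D * stableNorm S γ}

/-- The subgroup of inner automorphisms. -/
def Inn (Γ : Type*) [Group Γ] : Subgroup (MulAut Γ) := (MulAut.conj : Γ →* MulAut Γ).range

instance Inn.instNormal (Γ : Type*) [Group Γ] : (Inn Γ).Normal where
  conj_mem := by
    rintro _ ⟨g, rfl⟩ ψ
    refine ⟨ψ g, ?_⟩
    ext x
    simp [MulAut.conj_apply]

/-- The outer automorphism group `Out(Γ) = Aut(Γ) / Inn(Γ)`. -/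
abbrev Out (Γ : Type*) [Group Γ] : Type _ := MulAut Γ ⧸ Inn Γ

/-- Property FSL of a finitely generated group: for every word metric given by a finite symmetric
generating set and for every `D > 1`, the automorphisms that are `D`-Lipschitz for the stable norm
represent only finitely many elements of `Out(Γ)`. -/
def PropertyFSL (Γ : Type*) [Group Γ] : Prop :=
  Group.FG Γ ∧ ∀ S : Set Γ, IsFiniteSymmGen S → ∀ D : ℝ, 1 < D →
    ((fun ψ : MulAut Γ => (QuotientGroup.mk ψ : Out Γ)) '' lipschitzAut S D).Finite

theorem IsFiniteSymmGen.exists_word {S : Set Γ} (hS : IsFiniteSymmGen S) (g : Γ) :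
    ∃ l : List Γ, (∀ x ∈ l, x ∈ S) ∧ l.prod = g ∧ l.length = wordNorm S g := by
  have hne : {n : ℕ | ∃ l : List Γ, (∀ x ∈ l, x ∈ S) ∧ l.prod = g ∧ l.length = n}.Nonempty := by
    have hg : g ∈ (Subgroup.closure S).toSubmonoid := by rw [hS.gen]; trivial
    rw [Subgroup.closure_toSubmonoid] at hg
    obtain ⟨l, hl, hp⟩ := Submonoid.exists_list_of_mem_closure hg
    refine ⟨l.length, l, fun x hx => ?_, hp, rfl⟩
    rcases hl x hx with h | h
    · exact h
    · simpa using hS.symm _ h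
  exact Nat.sInf_mem hne

theorem IsFiniteSymmGen.wordNorm_mul_le {S : Set Γ} (hS : IsFiniteSymmGen S) (g h : Γ) :
    wordNorm S (g * h) ≤ wordNorm S g + wordNorm S h := by
  obtain ⟨l, hl, hp, hn⟩ := hS.exists_word g
  obtain ⟨m, hm, hq, hk⟩ := hS.exists_word h
  refine Nat.sInf_le ⟨l ++ m, fun x hx => ?_, by simp [hp, hq], by simp [hn, hk]⟩
  rcases List.mem_append.1 hx with hx | hx
  exacts [hl x hx, hm x hx]

theorem IsFiniteSymmGen.tendsto_stableNorm {S : Set Γ} (hS : IsFiniteSymmGen S) (γ : Γ) :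
    Filter.Tendsto (fun n : ℕ => (wordNorm S (γ ^ n) : ℝ) / n) Filter.atTop
      (nhds (stableNorm S γ)) := by
  have hsub : Subadditive (fun n : ℕ => (wordNorm S (γ ^ n) : ℝ)) := fun m n => by
    simp only [pow_add]
    exact_mod_cast hS.wordNorm_mul_le _ _
  refine tendsto_nhds_limUnder ⟨hsub.lim, hsub.tendsto_lim ⟨0, ?_⟩⟩
  rintro _ ⟨n, rfl⟩
  positivity

end HypGroup

end

namespace HypGroup

variable {Γ : Type*} [Group Γ]

/-! ### Word norms: balls, geodesics, change of generating set. -/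

section WordNorm

variable {S : Set Γ}

/-! Changing generators alters stable norms by bounded factors, so a generating set `S` with
hyperbolic word metric suffices. If `ψ` is `D`-Lipschitz, the elements `ψ s` and `ψ (s * t)` with
`s`, `t` in `S` have stable norm at most `2 * D`. A uniform version of Serre's lemma
(`exists_conj_wordNorm_le`) then conjugates `ψ '' S` into a ball whose radius does not depend on
`ψ`, and only finitely many automorphisms map `S` into that ball. Serre's lemma comes from
minimising the maximal displacement over base points: if the minimum were large, a short step along
the geodesic towards the worst image would lower every displacement (`wordNorm_conj_lt`), because
small stable norms force large Gromov products (`gromovProd_ge`). -/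

theorem wordNorm_one (S : Set Γ) : wordNorm S 1 = 0 :=
  Nat.le_zero.1 (Nat.sInf_le ⟨[], by simp, by simp, rfl⟩)

theorem IsFiniteSymmGen.wordNorm_inv_le (hS : IsFiniteSymmGen S) (g : Γ) :
    wordNorm S g⁻¹ ≤ wordNorm S g := by
  obtain ⟨l, hl, hp, hn⟩ := hS.exists_word g
  refine Nat.sInf_le ⟨(l.map (·⁻¹)).reverse, fun x hx => ?_, ?_, by simp [hn]⟩
  · obtain ⟨y, hy, rfl⟩ := List.mem_map.1 (List.mem_reverse.1 hx)
    exact hS.symm y (hl y hy)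
  · rw [← hp, List.prod_inv_reverse]

theorem IsFiniteSymmGen.wordNorm_inv (hS : IsFiniteSymmGen S) (g : Γ) :
    wordNorm S g⁻¹ = wordNorm S g :=
  le_antisymm (hS.wordNorm_inv_le g) (by simpa using hS.wordNorm_inv_le g⁻¹)

theorem wordNorm_le_one {s : Γ} (hs : s ∈ S) : wordNorm S s ≤ 1 :=
  Nat.sInf_le ⟨[s], by simpa using hs, by simp, rfl⟩

/-- A point at prescribed distance from `1` on a geodesic from `1` to `g`. -/
theorem IsFiniteSymmGen.exists_wordNorm_eq (hS : IsFiniteSymmGen S) (g : Γ) {t : ℕ}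
    (ht : t ≤ wordNorm S g) :
    ∃ z : Γ, wordNorm S z = t ∧ wordNorm S (z⁻¹ * g) = wordNorm S g - t := by
  obtain ⟨l, hl, hp, hn⟩ := hS.exists_word g
  have h₁ : wordNorm S (l.take t).prod ≤ t :=
    le_trans (Nat.sInf_le ⟨l.take t, fun x hx => hl x (List.mem_of_mem_take hx), rfl, rfl⟩)
      (l.length_take_le t)
  have hq : (l.take t).prod⁻¹ * g = (l.drop t).prod := by
    rw [← hp, ← List.prod_take_mul_prod_drop l t, inv_mul_cancel_left]
  have h₂ : wordNorm S ((l.take t).prod⁻¹ * g) ≤ wordNorm S g - t :=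
    Nat.sInf_le ⟨l.drop t, fun x hx => hl x (List.mem_of_mem_drop hx), hq.symm, by simp [hn]⟩
  have h₃ := hS.wordNorm_mul_le (l.take t).prod ((l.take t).prod⁻¹ * g)
  rw [mul_inv_cancel_left] at h₃
  exact ⟨(l.take t).prod, by omega, by omega⟩

theorem IsFiniteSymmGen.finite_wordNorm_le (hS : IsFiniteSymmGen S) (n : ℕ) :
    {g : Γ | wordNorm S g ≤ n}.Finite := by
  have : Finite S := hS.finite
  refine ((List.finite_length_le S n).image fun l => (l.map Subtype.val).prod).subset fun g hg => ?_
  obtain ⟨l, hl, hp, hn⟩ := hS.exists_word g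
  lift l to List S using hl
  exact ⟨l, by simpa [← hn] using hg, hp⟩

/-- Word norms of two finite generating sets are Lipschitz to each other. -/
theorem IsFiniteSymmGen.exists_wordNorm_le_mul {T : Set Γ} (hS : IsFiniteSymmGen S)
    (hT : IsFiniteSymmGen T) : ∃ C : ℕ, ∀ g, wordNorm T g ≤ C * wordNorm S g := by
  obtain ⟨C, hC⟩ := (hS.finite.image (wordNorm T)).bddAbove
  refine ⟨C, fun g => ?_⟩
  obtain ⟨l, hl, hp, hn⟩ := hS.exists_word g
  rw [← hn, ← hp]
  clear hp hn
  induction l with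
  | nil => simp [wordNorm_one]
  | cons a l ih =>
    rw [List.forall_mem_cons] at hl
    have h₁ := hT.wordNorm_mul_le a l.prod
    have h₂ := hC ⟨a, hl.1, rfl⟩
    have h₃ := ih hl.2
    rw [List.prod_cons, List.length_cons, mul_add_one]
    omega

end WordNorm

/-! ### Stable norm: conjugation and comparison. -/

section StableNorm

variable {S : Set Γ}

theorem IsFiniteSymmGen.stableNorm_nonneg (hS : IsFiniteSymmGen S) (g : Γ) :
    0 ≤ stableNorm S g :=
  ge_of_tendsto' (hS.tendsto_stableNorm g) fun n => by positivity

theorem IsFiniteSymmGen.stableNorm_le_wordNorm (hS : IsFiniteSymmGen S) (g : Γ) :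
    stableNorm S g ≤ wordNorm S g := by
  refine le_of_tendsto' (hS.tendsto_stableNorm g) fun n => ?_
  have h : wordNorm S (g ^ n) ≤ n * wordNorm S g := by
    induction n with
    | zero => simp [wordNorm_one]
    | succ n ih =>
      rw [pow_succ, add_one_mul]
      exact (hS.wordNorm_mul_le _ _).trans (by omega)
  refine div_le_of_le_mul₀ (by positivity) (by positivity) ?_
  rw [mul_comm]
  exact_mod_cast h

theorem IsFiniteSymmGen.stableNorm_conj_le (hS : IsFiniteSymmGen S) (x g : Γ) :
    stableNorm S (x * g * x⁻¹) ≤ stableNorm S g := by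
  have h : Filter.Tendsto (fun n : ℕ => (2 * wordNorm S x : ℝ) / n + (wordNorm S (g ^ n) : ℝ) / n)
      Filter.atTop (nhds (0 + stableNorm S g)) :=
    (tendsto_const_div_atTop_nhds_zero_nat _).add (hS.tendsto_stableNorm g)
  rw [zero_add] at h
  refine le_of_tendsto_of_tendsto' (hS.tendsto_stableNorm _) h fun n => ?_
  rw [conj_pow, ← add_div]
  gcongr
  have h₁ := hS.wordNorm_mul_le (x * g ^ n) x⁻¹
  have h₂ := hS.wordNorm_mul_le x (g ^ n)
  rw [hS.wordNorm_inv] at h₁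
  exact_mod_cast (show wordNorm S (x * g ^ n * x⁻¹) ≤ 2 * wordNorm S x + wordNorm S (g ^ n) by omega)

theorem IsFiniteSymmGen.stableNorm_le_mul {T : Set Γ} (hS : IsFiniteSymmGen S)
    (hT : IsFiniteSymmGen T) {C : ℕ} (hC : ∀ g, wordNorm T g ≤ C * wordNorm S g) (g : Γ) :
    stableNorm T g ≤ C * stableNorm S g := by
  refine le_of_tendsto_of_tendsto' (hT.tendsto_stableNorm g)
    ((hS.tendsto_stableNorm g).const_mul (C : ℝ)) fun n => ?_
  rw [← mul_div_assoc]
  gcongr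
  exact_mod_cast hC _

end StableNorm

/-! ### Displacement and stable norm in a hyperbolic group. -/

section Hyperbolic

variable {S : Set Γ} {δ : ℝ}

/-- The Gromov product of `g` and `h` based at `1`, for the word metric. -/
noncomputable def gromovProd (S : Set Γ) (g h : Γ) : ℝ :=
  ((wordNorm S g : ℝ) + wordNorm S h - wordNorm S (g⁻¹ * h)) / 2

theorem IsFiniteSymmGen.gromovProd_comm (hS : IsFiniteSymmGen S) (g h : Γ) :
    gromovProd S g h = gromovProd S h g := by
  rw [gromovProd, gromovProd, ← hS.wordNorm_inv (g⁻¹ * h), mul_inv_rev, inv_inv, add_comm]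

theorem IsFiniteSymmGen.min_gromovProd_le (hS : IsFiniteSymmGen S)
    (hδ : IsGromovHyperbolic (wordDist S) δ) (g h k : Γ) :
    min (gromovProd S g h) (gromovProd S h k) ≤ gromovProd S g k + δ := by
  have := hδ 1 g h k
  simp only [gromovProduct, wordDist, mul_one, hS.wordNorm_inv] at this
  simp only [gromovProd]
  linarith

theorem IsGromovHyperbolic.nonneg {X : Type*} [Nonempty X] {d : X → X → ℝ}
    (hδ : IsGromovHyperbolic d δ) : 0 ≤ δ := by
  obtain ⟨x⟩ := ‹Nonempty X›
  have := hδ x x x x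
  rw [min_self] at this
  linarith

/-- An element whose square is much longer than itself has large stable norm. -/
theorem IsFiniteSymmGen.wordNorm_sq_le (hS : IsFiniteSymmGen S)
    (hδ : IsGromovHyperbolic (wordDist S) δ) (g : Γ) :
    (wordNorm S (g * g) : ℝ) ≤ wordNorm S g + stableNorm S g + 2 * δ := by
  by_contra! hlt
  set η : ℝ := wordNorm S (g * g) - wordNorm S g - 2 * δ with hη
  have hδ₀ : 0 ≤ δ := hδ.nonneg
  have hη₀ : 0 < η := by linarith [hS.stableNorm_nonneg g]
  have step : ∀ m : ℕ, (wordNorm S (g ^ (m + 1)) : ℝ) + η ≤ wordNorm S (g ^ (m + 2)) := by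
    intro m
    induction m with
    | zero =>
      rw [zero_add, pow_one, zero_add, pow_two]
      linarith
    | succ m ih =>
      -- If the minimum is the second product, the last increment of the norm is at most `-η`,
      -- against `ih`; so it is the first, which gives the next increment.
      have h := hS.min_gromovProd_le hδ g⁻¹ (g ^ (m + 2)) g
      rw [hS.gromovProd_comm (g ^ (m + 2)) g] at h
      simp only [gromovProd, hS.wordNorm_inv, inv_inv] at h
      rw [← pow_succ', pow_succ' g (m + 1), inv_mul_cancel_left, ← pow_succ'] at h
      rcases min_le_iff.1 h with h | h
      · rw [show m + 1 + 1 = m + 2 from rfl, show m + 1 + 2 = m + 2 + 1 from rfl]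
        linarith
      · linarith
  have lower : ∀ m : ℕ, m * η ≤ wordNorm S (g ^ (m + 1)) := by
    intro m
    induction m with
    | zero => simp
    | succ m ih =>
      have := step m
      push_cast
      linarith
  have hlim : Filter.Tendsto (fun n : ℕ => η - η / n) Filter.atTop (nhds (η - 0)) :=
    tendsto_const_nhds.sub (tendsto_const_div_atTop_nhds_zero_nat _)
  rw [sub_zero] at hlim
  have : η ≤ stableNorm S g := by
    refine le_of_tendsto_of_tendsto hlim (hS.tendsto_stableNorm g) ?_
    filter_upwards [Filter.eventually_gt_atTop 0] with n hn
    obtain ⟨m, rfl⟩ := Nat.exists_eq_succ_of_ne_zero hn.ne'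
    have h := lower m
    rw [le_div_iff₀ (by positivity), sub_mul, div_mul_cancel₀ _ (by positivity)]
    push_cast
    linarith
  linarith

theorem IsFiniteSymmGen.gromovProd_inv_self_ge (hS : IsFiniteSymmGen S)
    (hδ : IsGromovHyperbolic (wordDist S) δ) {A : ℝ} {g : Γ} (hg : stableNorm S g ≤ A) :
    (wordNorm S g : ℝ) / 2 - A / 2 - δ ≤ gromovProd S g⁻¹ g := by
  have := hS.wordNorm_sq_le hδ g
  simp only [gromovProd, hS.wordNorm_inv, inv_inv]
  linarith

/-- Two elements such that they and their product have small stable norm have a large Gromov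
product. -/
theorem IsFiniteSymmGen.gromovProd_ge (hS : IsFiniteSymmGen S)
    (hδ : IsGromovHyperbolic (wordDist S) δ) {A : ℝ} {f g : Γ} (hf : stableNorm S f ≤ A)
    (hg : stableNorm S g ≤ A) (hfg : stableNorm S (f * g) ≤ A) :
    min (wordNorm S f : ℝ) (wordNorm S g) / 2 - A - 5 * δ ≤ gromovProd S f g := by
  have hδ₀ : 0 ≤ δ := hδ.nonneg
  have hA : 0 ≤ A := (hS.stableNorm_nonneg f).trans hf
  have e₁ := hS.gromovProd_inv_self_ge hδ hf
  have e₂ := hS.gromovProd_inv_self_ge hδ hg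
  have e₃ := hS.gromovProd_inv_self_ge hδ hfg
  have p : gromovProd S f⁻¹ g = ((wordNorm S f : ℝ) + wordNorm S g - wordNorm S (f * g)) / 2 := by
    simp only [gromovProd, hS.wordNorm_inv, inv_inv]
  have p₁ : gromovProd S f (f * g) = wordNorm S f - gromovProd S f⁻¹ g := by
    rw [p, gromovProd, inv_mul_cancel_left]
    ring
  have p₂ : gromovProd S (f * g)⁻¹ g⁻¹ = wordNorm S g - gromovProd S f⁻¹ g := by
    rw [p, gromovProd, inv_inv, mul_inv_cancel_right, hS.wordNorm_inv, hS.wordNorm_inv]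
    ring
  -- Write `p` for `(f⁻¹ | g)`. If `p` is at least half the smaller norm, the chain `f, f⁻¹, g`
  -- suffices. Otherwise the chain `f, f * g, (f * g)⁻¹, g⁻¹, g` does, since `‖f * g‖ / 2` is the
  -- mean of `‖f‖ - p` and `‖g‖ - p`.
  have c₁ := hS.min_gromovProd_le hδ f (f * g) g⁻¹
  have c₂ := hS.min_gromovProd_le hδ (f * g) (f * g)⁻¹ g⁻¹
  have c₃ := hS.min_gromovProd_le hδ f⁻¹ f g
  have c₄ := hS.min_gromovProd_le hδ f g⁻¹ g
  have c₅ := hS.min_gromovProd_le hδ f f⁻¹ g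
  rw [hS.gromovProd_comm (f * g) (f * g)⁻¹] at c₂
  rw [hS.gromovProd_comm f f⁻¹] at c₅
  have m₁ := min_le_left (wordNorm S f : ℝ) (wordNorm S g)
  have m₂ := min_le_right (wordNorm S f : ℝ) (wordNorm S g)
  rw [min_le_iff] at c₁ c₂ c₃ c₄ c₅
  rcases c₁ with c₁ | c₁ <;> rcases c₂ with c₂ | c₂ <;> rcases c₃ with c₃ | c₃ <;>
    rcases c₄ with c₄ | c₄ <;> rcases c₅ with c₅ | c₅ <;> linarith

/-- If a point far out moves a bounded amount towards `f₀`, the displacement of `f` decreases. -/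
theorem IsFiniteSymmGen.wordNorm_conj_lt (hS : IsFiniteSymmGen S)
    (hδ : IsGromovHyperbolic (wordDist S) δ) {A : ℝ} {f f₀ z : Γ} (hf : stableNorm S f ≤ A)
    (hf₀ : stableNorm S f₀ ≤ A) (hff₀ : stableNorm S (f * f₀) ≤ A)
    (hle : wordNorm S f ≤ wordNorm S f₀)
    (hz : 4 * δ < wordNorm S z) (hL : 4 * (wordNorm S z : ℝ) + 2 * A + 10 * δ ≤ wordNorm S f₀)
    (hzf₀ : (wordNorm S (z⁻¹ * f₀) : ℝ) = wordNorm S f₀ - wordNorm S z) :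
    wordNorm S (z⁻¹ * f * z) < wordNorm S f₀ := by
  have hδ₀ : 0 ≤ δ := hδ.nonneg
  have hA : 0 ≤ A := (hS.stableNorm_nonneg f).trans hf
  have hle' : (wordNorm S f : ℝ) ≤ wordNorm S f₀ := by exact_mod_cast hle
  rw [← Nat.cast_lt (α := ℝ)]
  -- A short `f` needs only the triangle inequality. Otherwise `hL` makes `(f | f₀)` and `(f | f⁻¹)`
  -- at least `‖z‖`, so `z` nearly lies on geodesics to both `f` and `f⁻¹`.
  rcases lt_or_ge (wordNorm S f : ℝ) (wordNorm S f₀ - 2 * wordNorm S z) with h | h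
  · have h₁ : (wordNorm S (z⁻¹ * f * z) : ℝ) ≤ wordNorm S (z⁻¹ * f) + wordNorm S z := by
      exact_mod_cast hS.wordNorm_mul_le _ _
    have h₂ : (wordNorm S (z⁻¹ * f) : ℝ) ≤ wordNorm S z⁻¹ + wordNorm S f := by
      exact_mod_cast hS.wordNorm_mul_le _ _
    rw [hS.wordNorm_inv] at h₂
    linarith
  · have q₀ : gromovProd S z f₀ = wordNorm S z := by
      rw [gromovProd, hzf₀]
      ring
    have q₁ := hS.gromovProd_ge hδ hf hf₀ hff₀
    rw [min_eq_left hle', hS.gromovProd_comm] at q₁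
    have q₂ := hS.gromovProd_inv_self_ge hδ hf
    rw [hS.gromovProd_comm] at q₂
    have c₁ : (wordNorm S z : ℝ) - δ ≤ gromovProd S z f := by
      rcases min_le_iff.1 (hS.min_gromovProd_le hδ z f₀ f) with c | c <;> linarith
    have c₂ : (wordNorm S z : ℝ) - 2 * δ ≤ gromovProd S z f⁻¹ := by
      rcases min_le_iff.1 (hS.min_gromovProd_le hδ z f f⁻¹) with c | c <;> linarith
    -- The first alternative gives `‖z⁻¹ * f * z‖ ≤ ‖f‖ - 2 * ‖z‖ + 8 * δ`, whence the threshold `4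
    -- * δ` on `‖z‖`.
    have c₃ := hS.min_gromovProd_le hδ z f (f * z)
    have r₁ : wordNorm S ((f * z)⁻¹) = wordNorm S (z⁻¹ * f⁻¹) := by rw [mul_inv_rev]
    rw [hS.wordNorm_inv] at r₁
    simp only [gromovProd, hS.wordNorm_inv, r₁, ← mul_assoc, inv_mul_cancel, one_mul] at c₁ c₂ c₃
    rcases min_le_iff.1 c₃ with c | c <;> linarith

/-- A quantitative form of Serre's lemma on elliptic isometries: a finite set of elements whose
products of length at most two have bounded stable norm can be conjugated into a fixed ball. -/
theorem IsFiniteSymmGen.exists_conj_wordNorm_le (hS : IsFiniteSymmGen S)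
    (hδ : IsGromovHyperbolic (wordDist S) δ) (A : ℝ) :
    ∃ K : ℕ, ∀ F : Set Γ, F.Finite → (∀ f ∈ F, stableNorm S f ≤ A) →
      (∀ f ∈ F, ∀ g ∈ F, stableNorm S (f * g) ≤ A) →
      ∃ x : Γ, ∀ f ∈ F, wordNorm S (x⁻¹ * f * x) ≤ K := by
  obtain ⟨t, ht⟩ := exists_nat_gt (4 * δ)
  obtain ⟨K, hK⟩ := exists_nat_gt (4 * (t : ℝ) + 2 * A + 10 * δ)
  refine ⟨max t K, fun F hF h₁ h₂ => ?_⟩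
  obtain ⟨F, rfl⟩ := hF.exists_finset_coe
  simp only [Finset.mem_coe] at h₁ h₂ ⊢
  set N : Γ → ℕ := fun x => F.sup fun f => wordNorm S (x⁻¹ * f * x) with hN
  -- A minimiser exists because `N` takes values in `ℕ`.
  let x := Function.argmin N
  have hx : ∀ y, N x ≤ N y := fun y => Function.argmin_le N y
  refine ⟨x, fun f hf => ?_⟩
  by_contra! hlt
  obtain ⟨f₀, hf₀, hmax⟩ := F.exists_max_image (fun f => wordNorm S (x⁻¹ * f * x)) ⟨f, hf⟩
  have hL := hlt.trans_le (hmax f hf)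
  obtain ⟨z, hzt, hz⟩ := hS.exists_wordNorm_eq (x⁻¹ * f₀ * x)
    ((le_max_left t K).trans hL.le)
  have hconj : ∀ g, stableNorm S (x⁻¹ * g * x) ≤ stableNorm S g := fun g => by
    simpa using hS.stableNorm_conj_le x⁻¹ g
  have hlt' : N (x * z) < wordNorm S (x⁻¹ * f₀ * x) := by
    rw [hN, Finset.sup_lt_iff (bot_le.trans_lt hL)]
    intro g hg
    have := hS.wordNorm_conj_lt hδ (A := A) (f := x⁻¹ * g * x) (f₀ := x⁻¹ * f₀ * x) (z := z)
      ((hconj g).trans (h₁ g hg)) ((hconj f₀).trans (h₁ f₀ hf₀))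
      (by simpa [mul_assoc] using (hconj (g * f₀)).trans (h₂ g hg f₀ hf₀)) (hmax g hg)
      (by rwa [hzt])
      (by
        rw [hzt]
        have : (K : ℝ) ≤ wordNorm S (x⁻¹ * f₀ * x) := by
          exact_mod_cast (le_max_right t K).trans hL.le
        linarith)
      (by rw [hz, hzt, Nat.cast_sub ((le_max_left t K).trans hL.le)])
    simpa [mul_assoc] using this
  exact absurd (hx (x * z)) (not_le.2 (hlt'.trans_le
    (Finset.le_sup (f := fun f => wordNorm S (x⁻¹ * f * x)) hf₀)))

end Hyperbolic

/-- An automorphism is determined by its restriction to `S`, here a map from a finite set to a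
finite ball. -/
theorem IsFiniteSymmGen.finite_mulAut_wordNorm_le {S : Set Γ} (hS : IsFiniteSymmGen S) (K : ℕ) :
    {φ : MulAut Γ | ∀ s ∈ S, wordNorm S (φ s) ≤ K}.Finite := by
  have : Finite S := hS.finite
  have : Finite {g : Γ | wordNorm S g ≤ K} := hS.finite_wordNorm_le K
  let r : {φ : MulAut Γ | ∀ s ∈ S, wordNorm S (φ s) ≤ K} → S → {g : Γ | wordNorm S g ≤ K} :=
    fun φ s => ⟨φ.1 s, φ.2 s s.2⟩
  refine Finite.of_injective r fun φ ψ h => Subtype.ext (MulEquiv.toMonoidHom_injective ?_)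
  exact MonoidHom.eq_of_eqOn_dense hS.gen fun s hs => congrArg Subtype.val (congrFun h ⟨s, hs⟩)

theorem IsFiniteSymmGen.finite_image_lipschitzAut {S : Set Γ} (hS : IsFiniteSymmGen S) {δ : ℝ}
    (hδ : IsGromovHyperbolic (wordDist S) δ) {D : ℝ} (hD : 0 ≤ D) :
    ((fun ψ : MulAut Γ => (QuotientGroup.mk ψ : Out Γ)) '' lipschitzAut S D).Finite := by
  obtain ⟨K, hK⟩ := hS.exists_conj_wordNorm_le hδ (D * 2)
  refine ((hS.finite_mulAut_wordNorm_le K).image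
    fun ψ : MulAut Γ => (QuotientGroup.mk ψ : Out Γ)).subset ?_
  rintro _ ⟨ψ, hψ, rfl⟩
  have bound : ∀ g, wordNorm S g ≤ 2 → stableNorm S (ψ g) ≤ D * 2 := fun g hg =>
    (hψ g).trans (mul_le_mul_of_nonneg_left
      ((hS.stableNorm_le_wordNorm g).trans (by exact_mod_cast hg)) hD)
  obtain ⟨x, hx⟩ := hK (ψ '' S) (hS.finite.image _)
    (by
      rintro _ ⟨s, hs, rfl⟩
      exact bound s ((wordNorm_le_one hs).trans one_le_two))
    (by
      rintro _ ⟨s, hs, rfl⟩ _ ⟨t, ht, rfl⟩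
      rw [← map_mul]
      exact bound _ ((hS.wordNorm_mul_le s t).trans
        (add_le_add (wordNorm_le_one hs) (wordNorm_le_one ht))))
  refine ⟨MulAut.conj x⁻¹ * ψ, fun s hs => ?_, ?_⟩
  · simpa using hx (ψ s) ⟨s, hs, rfl⟩
  · have : (QuotientGroup.mk (MulAut.conj x⁻¹) : Out Γ) = 1 :=
      (QuotientGroup.eq_one_iff _).2 ⟨x⁻¹, rfl⟩
    simp only [QuotientGroup.mk_mul, this, one_mul]

end HypGroup

theorem mainTheorem8 (Γ : Type*) [Group Γ] (hΓ : HypGroup.IsHyperbolicGroup Γ) :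
    HypGroup.PropertyFSL Γ := by
  obtain ⟨T, hT, δ, hδ⟩ := hΓ
  refine ⟨Group.fg_iff.2 ⟨T, hT.gen, hT.finite⟩, fun S hS D hD => ?_⟩
  obtain ⟨C, hC⟩ := hS.exists_wordNorm_le_mul hT
  obtain ⟨C', hC'⟩ := hT.exists_wordNorm_le_mul hS
  have hD₀ : 0 ≤ D := by linarith
  -- `C` and `C'` are the costs of passing from `T` to `S` and back.
  refine (hT.finite_image_lipschitzAut hδ (D := C * (D * C')) (by positivity)).subset
    (Set.image_mono fun ψ hψ γ => ?_)
  calc HypGroup.stableNorm T (ψ γ) ≤ C * HypGroup.stableNorm S (ψ γ) := hS.stableNorm_le_mul hT hC _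
    _ ≤ C * (D * (C' * HypGroup.stableNorm T γ)) := by
        gcongr
        exact (hψ γ).trans (by gcongr; exact hT.stableNorm_le_mul hS hC' γ)
    _ = C * (D * C') * HypGroup.stableNorm T γ := by ring
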